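/- **Setting.** Let $p$ be a prime; put $\delta=p-1$ if $p$ is odd and $\delta=2$ if $p=2$. Let $k_0$ be an integer with $0\le k_0<\delta$ and put $k_n=k_0+n\delta$ for $n\in\mathbf Z$. Let $d,d^{\rm new}:\mathbf Z\to\mathbf Z$ be functions and put $d_p=2d+d^{\rm new}$. Assume: * $\lim_{n\to+\infty}d(n)=+\infty$ and $\lim_{n\to-\infty}\bigl(d(n)+d^{\rm new}(n)\bigr)=-\infty$; * $d$, $d+d^{\rm new}$ and $d_p$ are non-decreasing; * there are real constants $A,B>0$ such that $d(n)=An+O(1)$ and $d^{\rm new}(n)=Bn+O(1)$ as $n\to+\infty$. Fix a topological generator $\gamma$ of $1+2p\mathbf Z_p$ and put $w_{k}=\gamma^{k}-1\in\mathbf Z_p$, except that $w_k=\gamma^{k-1}-1$ if $p=2$ and $k_0=1$. For $i\ge 0$ let $g_i(w)\in\mathbf Z_p[w]$ be the monic polynomial whose zeroes are exactly the (finitely many) points $w_{k_n}$ with $d(n)<i<d(n)+d^{\rm new}(n)$, where $w_{k_n}$ has multiplicity $i-d(n)$ if $d(n)<i\le d(n)+\tfrac12 d^{\rm new}(n)$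 and $d(n)+d^{\rm new}(n)-i$ if $d(n)+\tfrac12 d^{\rm new}(n)\le i<d(n)+d^{\rm new}(n)$. The (abstract) ghost series is $G(w,t)=\sum_{i\ge0}g_i(w)t^i$. Write $G_{k_n}(t)=G(w_{k_n},t)\in\mathbf Z_p[[t]]$. Its Newton polygon is the lower convex hull of the points $(i,v_p(g_i(w_{k_n})))$ with $g_i(w_{k_n})\ne0$, where $v_p(p)=1$. Let $s_1(k_n)\le s_2(k_n)\le\cdots$ be its slopes listed with multiplicity, so that $s_i(k_n)$ is the slope of the polygon over $[i-1,i]$ (for all sufficiently large $n$ the constant term $g_0(w_{k_n})$ is non-zero, so that the polygon starts at $i=0$). **Corollary 3.2.** As $n\to+\infty$, $$s_{d(n)}(k_n)=\frac{p}{(p-1)^2}\cdot\frac{B^2}{(A+B)(2A+B)}\cdot k_n+O(\log n),$$ and, for every $\varepsilon>0$, $$s_{d_p(n)}(k_n)=\frac{p}{(p-1)^2}\cdot\frac{B^2}{A(A+B)}\cdot k_n+O(n^{1/2+\varepsilon}).$$ The implied constants may depend on $p,k_0,\gamma,d,d^{\rm new},A,B$ and, in the second estimate, on $\varepsilon$.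 -/

import Mathlib

open Filter Asymptotics

namespace Ghost

noncomputable section

/-- `δ`: the size of the torsion subgroup of `ℤ_pˣ`. -/
def delta (p : ℕ) : ℤ := if p = 2 then 2 else (p : ℤ) - 1

/-- The integer weight `k_n = k₀ + n δ`. -/
def wt (p : ℕ) (k₀ n : ℤ) : ℤ := k₀ + n * delta p

/-- `γ` is a topological generator of the multiplicative group `1 + 2pℤ_p`. -/
def IsTopGen (p : ℕ) [Fact p.Prime] (γ : ℤ_[p]ˣ) : Prop :=
  closure (Subgroup.zpowers γ : Set ℤ_[p]ˣ) =
    {u : ℤ_[p]ˣ | (2 * (p : ℤ_[p])) ∣ ((u : ℤ_[p]) - 1)}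

/-- The coordinate `w_κ` on the `k₀`-th component of weight space, at a `ℤ_pˣ`-valued character
`κ`: it is `κ(γ) - 1`, except that it is `κ(γ)γ⁻¹ - 1` if `p = 2` and `k₀ = 1`. -/
def coord (p : ℕ) [Fact p.Prime] (k₀ : ℤ) (γ : ℤ_[p]ˣ) (κ : ℤ_[p]ˣ →* ℤ_[p]ˣ) : ℤ_[p] :=
  if p = 2 ∧ k₀ = 1 then ((κ γ * γ⁻¹ : ℤ_[p]ˣ) : ℤ_[p]) - 1 else (κ γ : ℤ_[p]) - 1

/-- The coordinate `w_{k_n}` of the integer weight `k_n`, i.e. of the character `z ↦ z ^ k_n`. -/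
def wtCoord (p : ℕ) [Fact p.Prime] (k₀ : ℤ) (γ : ℤ_[p]ˣ) (n : ℤ) : ℤ_[p] :=
  coord p k₀ γ (zpowGroupHom (wt p k₀ n))

/-- The multiplicity `m_i(k_n)`: it is `i - d(n)` if `d(n) < i ≤ d(n) + d^new(n)/2`, it is
`d(n) + d^new(n) - i` if `d(n) + d^new(n)/2 ≤ i < d(n) + d^new(n)`, and `0` for all other `i`. -/
def mult (d dnew : ℤ → ℤ) (i n : ℤ) : ℕ :=
  if d n < i ∧ 2 * i ≤ 2 * d n + dnew n then (i - d n).toNat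
  else if 2 * d n + dnew n ≤ 2 * i ∧ i < d n + dnew n then (d n + dnew n - i).toNat
  else 0

/-- The coefficient `g_i`: the monic polynomial in `w` whose zeroes are the `w_{k_n}` with
`d(n) < i < d(n) + d^new(n)`, with multiplicities `m_i(k_n)`. There are finitely many such `n`
as soon as `d(n) → ∞` for `n → ∞` and `d(n) + d^new(n) → -∞` for `n → -∞`. -/
def coeff (p : ℕ) [Fact p.Prime] (d dnew : ℤ → ℤ) (k₀ : ℤ) (γ : ℤ_[p]ˣ) (i : ℕ) :
    Polynomial ℤ_[p] :=
  ∏ᶠ n : ℤ, (Polynomial.X - Polynomial.C (wtCoord p k₀ γ n)) ^ mult d dnew i n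

/-- The abstract ghost series `G(w,t) = ∑ g_i(w) t^i` in `ℤ_p[w][[t]]`. -/
def series (p : ℕ) [Fact p.Prime] (d dnew : ℤ → ℤ) (k₀ : ℤ) (γ : ℤ_[p]ˣ) :
    PowerSeries (Polynomial ℤ_[p]) :=
  PowerSeries.mk (coeff p d dnew k₀ γ)

/-- The specialization `G_{k_n}(t) = G(w_{k_n}, t)`. -/
def seriesAt (p : ℕ) [Fact p.Prime] (d dnew : ℤ → ℤ) (k₀ : ℤ) (γ : ℤ_[p]ˣ) (n : ℤ) :
    PowerSeries ℤ_[p] :=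
  PowerSeries.map (Polynomial.evalRingHom (wtCoord p k₀ γ n)) (series p d dnew k₀ γ)

/-- The points `(i, v_p(a_i))`, for `a_i ≠ 0`, attached to `P = ∑ a_i t^i`. -/
def newtonPoints {p : ℕ} [Fact p.Prime] (P : PowerSeries ℤ_[p]) : Set (ℝ × ℝ) :=
  {z | ∃ i : ℕ, PowerSeries.coeff i P ≠ 0 ∧
    z = ((i : ℝ), ((PowerSeries.coeff i P).valuation : ℝ))}

/-- The Newton polygon of `P`, as a function of the abscissa: the lower boundary of the convex
hull of the points `(i, v_p(a_i))`. -/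
def newtonPolygon {p : ℕ} [Fact p.Prime] (P : PowerSeries ℤ_[p]) (x : ℝ) : ℝ :=
  sInf {y : ℝ | (x, y) ∈ convexHull ℝ (newtonPoints P)}

/-- The `i`-th slope (`i ≥ 1`, slopes in increasing order and with multiplicity) of the Newton
polygon of a series with non-zero constant term and infinitely many non-zero terms: the slope of
the polygon over the segment `[i - 1, i]`. -/
def slope {p : ℕ} [Fact p.Prime] (P : PowerSeries ℤ_[p]) (i : ℤ) : ℝ :=
  newtonPolygon P (i : ℝ) - newtonPolygon P ((i : ℝ) - 1)

/-- The ghost slope `s_i(k_n)`. -/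
def ghostSlope (p : ℕ) [Fact p.Prime] (d dnew : ℤ → ℤ) (k₀ : ℤ) (γ : ℤ_[p]ˣ) (i n : ℤ) : ℝ :=
  slope (seriesAt p d dnew k₀ γ n) i

end

end Ghost

/-! The point of abscissa `i` on the polygon of `G_{k_n}` has ordinate `height p d dnew n i`, the
sum over `m` of `mult d dnew i m * wgt p (n - m)`, because `w_{k_n} - w_{k_m}` is a unit times `δ (n
- m) 2p`. The proof shows that the increments of this function are linear in `i` up to a logarithm,
uniformly in `n`.

For fixed `m`, the increment of the tent function `i ↦ mult d dnew i m` is a signed sum of four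
indicators of conditions `F m ≤ x`, where `F` grows linearly with rate `A`, `2A + B` (twice) or `A +
B`, and `x` is `i` or `2i`. By Legendre's formula, `wgt` has mean `avgWgt p` over an interval, up to
a logarithm in the total. Summing over `m` therefore gives increments `α i + O(log (n + i))`
(`exists_height_increment`), where `α / avgWgt p = 1/A - 4/(2A + B) + 1/(A + B) = B² / (A (A + B)
(2A + B))`.

No point exists over abscissas where the coefficient vanishes, but `height` is still defined there
and obeys the same estimate, so increments can be summed across the gap. As the increments are
nearly increasing, whenever the points over `i - 1` and `i` both exist the slope there is `α i +
O(log (n + i))` (`slope_le`, `le_slope`, `exists_slope_bound`). Taking `i = d(n) ~ A n` and `i =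
d_p(n) ~ (2A + B) n` gives both formulas, the second even with error `O(log n)`. -/

/-! ### Slopes of Newton polygons via supporting convex functions. -/

theorem le_on_convexHull {S : Set (ℝ × ℝ)} {h : ℝ → ℝ} (hh : ConvexOn ℝ Set.univ h)
    (hS : ∀ z ∈ S, h z.1 ≤ z.2) {x y : ℝ} (hxy : (x, y) ∈ convexHull ℝ S) : h x ≤ y := by
  have hconv : Convex ℝ {z : ℝ × ℝ | h z.1 ≤ z.2} := by
    simpa using hh.convex_epigraph
  exact convexHull_min hS hconv hxy

theorem convexOn_max_lines (x₀ y₀ s t : ℝ) :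
    ConvexOn ℝ Set.univ fun x : ℝ => max (y₀ + s * (x - x₀)) (y₀ + t * (x - x₀)) := by
  have key : ∀ r : ℝ, ConvexOn ℝ Set.univ fun x : ℝ => y₀ + r * (x - x₀) := by
    intro r
    refine ⟨convex_univ, fun x _ y _ a b _ _ hab => le_of_eq ?_⟩
    simp only [smul_eq_mul]
    linear_combination (y₀ - r * x₀) * (-hab)
  exact (key s).sup (key t)

namespace Ghost

variable {p : ℕ} [Fact p.Prime]

theorem newtonPoints_snd_nonneg (P : PowerSeries ℤ_[p]) :
    ∀ z ∈ newtonPoints P, 0 ≤ z.2 := by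
  rintro _ ⟨i, -, rfl⟩
  exact Nat.cast_nonneg _

theorem bddBelow_newton (P : PowerSeries ℤ_[p]) (x : ℝ) :
    BddBelow {y : ℝ | (x, y) ∈ convexHull ℝ (newtonPoints P)} :=
  ⟨0, fun _ hy => le_on_convexHull (h := fun _ => 0) (convexOn_const _ convex_univ)
    (newtonPoints_snd_nonneg P) hy⟩

theorem newtonPolygon_le (P : PowerSeries ℤ_[p]) {x y : ℝ}
    (h : (x, y) ∈ convexHull ℝ (newtonPoints P)) : newtonPolygon P x ≤ y :=
  csInf_le (bddBelow_newton P x) h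

/-- The point of abscissa `x` keeps the set of ordinates nonempty; the real infimum of an empty set
would be the default value `0`. -/
theorem le_newtonPolygon (P : PowerSeries ℤ_[p]) {x y₀ : ℝ} {h : ℝ → ℝ}
    (hne : (x, y₀) ∈ newtonPoints P) (hh : ConvexOn ℝ Set.univ h)
    (hS : ∀ z ∈ newtonPoints P, h z.1 ≤ z.2) : h x ≤ newtonPolygon P x :=
  le_csInf ⟨y₀, subset_convexHull ℝ _ hne⟩ fun _ hy => le_on_convexHull hh hS hy

/-- The Newton polygon lies below the chord from one of its points to a defining point. -/
theorem newtonPolygon_chord (P : PowerSeries ℤ_[p]) {x y₀ a ya c : ℝ}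
    (hne : (x, y₀) ∈ newtonPoints P) (ha : (a, ya) ∈ newtonPoints P)
    (hc0 : 0 ≤ c) (hc1 : c < 1) :
    newtonPolygon P ((1 - c) * x + c * a) ≤ (1 - c) * newtonPolygon P x + c * ya := by
  have h1 : (newtonPolygon P ((1 - c) * x + c * a) - c * ya) / (1 - c) ≤ newtonPolygon P x := by
    refine le_csInf ⟨y₀, subset_convexHull ℝ _ hne⟩ fun u hu => ?_
    rw [div_le_iff₀ (by linarith)]
    have hmem : ((1 - c) * x + c * a, (1 - c) * u + c * ya) ∈
        convexHull ℝ (newtonPoints P) :=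
      convex_convexHull ℝ (newtonPoints P) hu (subset_convexHull ℝ _ ha)
        (by linarith : (0 : ℝ) ≤ 1 - c) hc0 (by ring)
    have := newtonPolygon_le P hmem
    linarith
  rw [div_le_iff₀ (by linarith)] at h1
  linarith

theorem mem_newtonPoints (P : PowerSeries ℤ_[p]) {i : ℕ} (h : PowerSeries.coeff i P ≠ 0) :
    ((i : ℝ), ((PowerSeries.coeff i P).valuation : ℝ)) ∈ newtonPoints P :=
  ⟨i, h, rfl⟩

/-- Only the points to the left matter: if they lie above a line of slope `s` through the point over
`i + 1`, a steeper polygon over `[i, i + 1]` could be raised at `i`. The point over `i + 1` need not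
lie on the polygon. -/
theorem slope_le (P : PowerSeries ℤ_[p]) {i : ℕ} {s : ℝ}
    (h0 : PowerSeries.coeff i P ≠ 0) (h1 : PowerSeries.coeff (i + 1) P ≠ 0)
    (hs : ∀ a ≤ i, PowerSeries.coeff a P ≠ 0 →
      ((PowerSeries.coeff (i + 1) P).valuation : ℝ) - s * ((i : ℝ) + 1 - a) ≤
        (PowerSeries.coeff a P).valuation) :
    slope P ((i : ℤ) + 1) ≤ s := by
  have m0 := mem_newtonPoints P h0
  have m1 := mem_newtonPoints P h1
  unfold slope
  push_cast at m1 ⊢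
  rw [add_sub_cancel_right]
  set N := newtonPolygon P with hN
  have hN1 : N ((i : ℝ) + 1) ≤ (PowerSeries.coeff (i + 1) P).valuation :=
    newtonPolygon_le P (subset_convexHull ℝ _ m1)
  by_contra! hlt
  set t := N ((i : ℝ) + 1) - N i with ht
  -- If the slope `t` exceeded `s`, the larger of the lines of slopes `s` and `t` through the
  -- polygon at `i + 1` would still minorize all points: on the left the `s`-line dominates and `hs`
  -- applies, on the right the `t`-line dominates and convexity of the polygon applies. At `i` it
  -- would exceed the polygon.
  have := le_newtonPolygon P m0 (convexOn_max_lines ((i : ℝ) + 1) (N ((i : ℝ) + 1)) s t) (by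
    rintro _ ⟨a, ha, rfl⟩
    simp only
    rcases Nat.lt_or_ge i a with hia | hia
    · have hia' : (i : ℝ) + 1 ≤ a := by exact_mod_cast hia
      have hc := newtonPolygon_chord P m0 (mem_newtonPoints P ha)
        (c := 1 / ((a : ℝ) - i)) (by apply div_nonneg <;> linarith)
      rcases eq_or_lt_of_le hia' with he | hl
      · have : a = i + 1 := by exact_mod_cast he.symm
        subst this
        push_cast
        simpa using hN1
      · have hpos : 0 < (a : ℝ) - i := by linarith
        specialize hc (by rw [div_lt_one hpos]; linarith)
        have e : (1 - 1 / ((a : ℝ) - i)) * i + 1 / ((a : ℝ) - i) * a = i + 1 := by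
          field_simp; ring
        rw [e, ← hN] at hc
        have hc' : N ((i : ℝ) + 1) * ((a : ℝ) - i) ≤
            ((a : ℝ) - i - 1) * N i + (PowerSeries.coeff a P).valuation := by
          have := mul_le_mul_of_nonneg_right hc hpos.le
          refine this.trans (le_of_eq ?_)
          field_simp
        refine max_le ?_ ?_
        · nlinarith
        · nlinarith
    · have hia' : (a : ℝ) ≤ i := by exact_mod_cast hia
      have := hs a hia ha
      refine max_le ?_ ?_
      · nlinarith
      · nlinarith)
  have h2 := le_trans (le_max_left _ _) this
  rw [← hN] at h2
  linarith

/-- Mirror image of `slope_le`, with lines through the polygon at `i` and the roles of left and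
right exchanged. -/
theorem le_slope (P : PowerSeries ℤ_[p]) {i : ℕ} {s : ℝ}
    (h0 : PowerSeries.coeff i P ≠ 0) (h1 : PowerSeries.coeff (i + 1) P ≠ 0)
    (hs : ∀ b, i + 1 ≤ b → PowerSeries.coeff b P ≠ 0 →
      ((PowerSeries.coeff i P).valuation : ℝ) + s * ((b : ℝ) - i) ≤
        (PowerSeries.coeff b P).valuation) :
    s ≤ slope P ((i : ℤ) + 1) := by
  have m0 := mem_newtonPoints P h0
  have m1 := mem_newtonPoints P h1
  unfold slope
  push_cast at m1 ⊢
  rw [add_sub_cancel_right]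
  set N := newtonPolygon P with hN
  have hN1 : N i ≤ (PowerSeries.coeff i P).valuation :=
    newtonPolygon_le P (subset_convexHull ℝ _ m0)
  by_contra! hlt
  set t := N ((i : ℝ) + 1) - N i with ht
  have := le_newtonPolygon P m1 (convexOn_max_lines (i : ℝ) (N i) s t) (by
    rintro _ ⟨a, ha, rfl⟩
    simp only
    rcases Nat.lt_or_ge i a with hia | hia
    · have hia' : (i : ℝ) + 1 ≤ a := by exact_mod_cast hia
      have := hs a hia ha
      refine max_le ?_ ?_
      · nlinarith
      · nlinarith
    · have hia' : (a : ℝ) ≤ i := by exact_mod_cast hia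
      have hpos : 0 < (i : ℝ) + 1 - a := by linarith
      have hc := newtonPolygon_chord P m1 (mem_newtonPoints P ha)
        (c := 1 / ((i : ℝ) + 1 - a)) (by positivity)
      rcases eq_or_lt_of_le hia with he | hl
      · subst he
        simpa using hN1
      · have hl' : (a : ℝ) < i := by exact_mod_cast hl
        specialize hc (by rw [div_lt_one hpos]; linarith)
        have e : (1 - 1 / ((i : ℝ) + 1 - a)) * (i + 1) + 1 / ((i : ℝ) + 1 - a) * a = i := by
          field_simp; ring
        rw [e, ← hN] at hc
        have hc' : N i * ((i : ℝ) + 1 - a) ≤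
            ((i : ℝ) - a) * N (i + 1) + (PowerSeries.coeff a P).valuation := by
          have := mul_le_mul_of_nonneg_right hc hpos.le
          refine this.trans (le_of_eq ?_)
          field_simp
          ring
        refine max_le ?_ ?_
        · nlinarith
        · nlinarith)
  have h2 := le_trans (le_max_left _ _) this
  rw [← hN] at h2
  linarith

end Ghost

/-! ### Valuations of differences of weight coordinates and of ghost coefficients. -/

namespace Ghost

variable {p : ℕ} [Fact p.Prime]

theorem isUnit_of_dvd_sub {x y : ℤ_[p]} (hy : IsUnit y) (h : (p : ℤ_[p]) ∣ x - y) : IsUnit x := by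
  by_contra hx
  rw [PadicInt.not_isUnit_iff, PadicInt.norm_lt_one_iff_dvd] at hx
  have : (p : ℤ_[p]) ∣ y := by simpa using dvd_sub hx h
  rw [← PadicInt.norm_lt_one_iff_dvd, PadicInt.isUnit_iff.mp hy] at this
  exact lt_irrefl _ this

theorem isUnit_natCast_of_not_dvd {n : ℕ} (h : ¬ p ∣ n) : IsUnit (n : ℤ_[p]) := by
  rw [PadicInt.isUnit_iff, PadicInt.norm_natCast_eq_one_iff]
  exact (Nat.Prime.coprime_iff_not_dvd Fact.out).mpr h

theorem dvd_geom_sum_sub {x y : ℤ_[p]} (h : y ∣ x - 1) (n : ℕ) :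
    y ∣ ∑ i ∈ Finset.range n, x ^ i - n := by
  have : ∑ i ∈ Finset.range n, x ^ i - (n : ℤ_[p]) = ∑ i ∈ Finset.range n, (x ^ i - 1) := by
    simp [Finset.sum_sub_distrib]
  rw [this]
  refine Finset.dvd_sum fun i _ => h.trans ?_
  simpa using sub_dvd_pow_sub_pow x 1 i

/-- For `x ≡ 1` modulo `2p`, the sum `1 + x + ⋯ + x ^ (p - 1)` is `p` times a unit. -/
theorem exists_geom_sum_prime {x : ℤ_[p]} (h : 2 * (p : ℤ_[p]) ∣ x - 1) :
    ∃ u : ℤ_[p]ˣ, ∑ i ∈ Finset.range p, x ^ i = u * p := by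
  have key : (p : ℤ_[p]) ^ 2 ∣ ∑ i ∈ Finset.range p, x ^ i - p := by
    -- For `p = 2` the difference is `x - 1`, and the hypothesis modulo `2p` is exactly divisibility
    -- by `p² = 4`; congruence modulo `p` would not suffice.
    rcases (Fact.out : p.Prime).eq_two_or_odd' with rfl | hodd
    · rw [Finset.sum_range_succ, Finset.sum_range_one]
      convert h using 1 <;> push_cast <;> ring
    · obtain ⟨b, hb⟩ := (Dvd.intro_left _ rfl).trans h
      have := odd_sq_dvd_geom_sum₂_sub (1 : ℤ_[p]) b hodd
      rw [← hb] at this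
      simpa using this
  obtain ⟨c, hc⟩ := key
  have hu : IsUnit (1 + p * c) := isUnit_of_dvd_sub isUnit_one (by simp)
  refine ⟨hu.unit, ?_⟩
  rw [IsUnit.unit_spec]
  linear_combination hc

/-- Induction on the prime factors of `n`: a prime factor `q` multiplies `x ^ a - 1` by a geometric
sum of length `q`, which is congruent to the unit `q` modulo `p` if `q ≠ p`, and is `p` times a unit
if `q = p`. -/
theorem exists_unit_pow_sub_one (n : ℕ) : ∀ x : ℤ_[p], 2 * (p : ℤ_[p]) ∣ x - 1 →
    ∃ u : ℤ_[p]ˣ, x ^ n - 1 = u * n * (x - 1) := by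
  induction n using induction_on_primes with
  | zero => exact fun x _ => ⟨1, by simp⟩
  | one => exact fun x _ => ⟨1, by simp⟩
  | prime_mul q a hq ih =>
    intro x hx
    obtain ⟨u, hu⟩ := ih x hx
    have hxa : 2 * (p : ℤ_[p]) ∣ x ^ a - 1 := hx.trans (by simpa using sub_dvd_pow_sub_pow x 1 a)
    have hgeom := geom_sum_mul (x ^ a) q
    obtain ⟨v, hv⟩ : ∃ v : ℤ_[p]ˣ, ∑ i ∈ Finset.range q, (x ^ a) ^ i = v * q := by
      by_cases hqp : q = p
      · subst hqp
        exact exists_geom_sum_prime hxa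
      · have hun : IsUnit (q : ℤ_[p]) := isUnit_natCast_of_not_dvd fun hd =>
          hqp ((Nat.prime_dvd_prime_iff_eq Fact.out hq).mp hd).symm
        have hs : IsUnit (∑ i ∈ Finset.range q, (x ^ a) ^ i) :=
          isUnit_of_dvd_sub hun ((dvd_mul_left _ _).trans (dvd_geom_sum_sub hxa q))
        refine ⟨hs.unit * hun.unit⁻¹, ?_⟩
        rw [Units.val_mul, mul_assoc]
        simp
    refine ⟨v * u, ?_⟩
    rw [mul_comm q a, pow_mul, ← hgeom, hv, hu]
    push_cast
    ring

theorem exists_unit_zpow_sub_one {γ : ℤ_[p]ˣ} (h : 2 * (p : ℤ_[p]) ∣ (γ : ℤ_[p]) - 1) (j : ℤ) :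
    ∃ u : ℤ_[p]ˣ, ((γ ^ j : ℤ_[p]ˣ) : ℤ_[p]) - 1 = u * j * ((γ : ℤ_[p]) - 1) := by
  obtain ⟨n, rfl | rfl⟩ := j.eq_nat_or_neg
  · obtain ⟨u, hu⟩ := exists_unit_pow_sub_one n (γ : ℤ_[p]) h
    exact ⟨u, by simpa using hu⟩
  · obtain ⟨u, hu⟩ := exists_unit_pow_sub_one n (γ : ℤ_[p]) h
    refine ⟨(γ ^ n)⁻¹ * u, ?_⟩
    have h1 : (((γ ^ n)⁻¹ : ℤ_[p]ˣ) : ℤ_[p]) * (γ : ℤ_[p]) ^ n = 1 := by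
      rw [← Units.val_pow_eq_pow_val, Units.inv_mul]
    rw [zpow_neg, zpow_natCast, Units.val_mul]
    push_cast
    rw [← Units.val_pow_eq_pow_val] at *
    linear_combination (-(((γ ^ n)⁻¹ : ℤ_[p]ˣ) : ℤ_[p])) * hu + h1

theorem isClosed_setOf_dvd_sub_one (a : ℤ_[p]) :
    IsClosed {u : ℤ_[p]ˣ | a ∣ (u : ℤ_[p]) - 1} := by
  have h1 : IsClosed {x : ℤ_[p] | a ∣ x} := by
    have : {x : ℤ_[p] | a ∣ x} = Set.range fun c => a * c := by
      ext x
      simp [dvd_def, eq_comm]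
    rw [this]
    exact (isCompact_range (by fun_prop)).isClosed
  exact h1.preimage (Units.continuous_val.sub continuous_const)

theorem IsTopGen.dvd {γ : ℤ_[p]ˣ} (h : IsTopGen p γ) : 2 * (p : ℤ_[p]) ∣ (γ : ℤ_[p]) - 1 := by
  have : γ ∈ closure (Subgroup.zpowers γ : Set ℤ_[p]ˣ) :=
    subset_closure (Subgroup.mem_zpowers γ)
  rw [h] at this
  exact this

/-- If `γ - 1` were divisible by `2p²`, so would be `u - 1` for every `u` in the closure of the
powers of `γ`, a closed condition that fails at `u = 1 + 2p`. -/
theorem IsTopGen.exists_unit {γ : ℤ_[p]ˣ} (h : IsTopGen p γ) :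
    ∃ u : ℤ_[p]ˣ, (γ : ℤ_[p]) - 1 = u * (2 * p) := by
  obtain ⟨c, hc⟩ := h.dvd
  have hp0 : (p : ℤ_[p]) ≠ 0 := Nat.cast_ne_zero.mpr (Fact.out : p.Prime).ne_zero
  suffices hcu : IsUnit c from ⟨hcu.unit, by rw [IsUnit.unit_spec, hc]; ring⟩
  by_contra hcu
  rw [PadicInt.not_isUnit_iff, PadicInt.norm_lt_one_iff_dvd] at hcu
  have hsub : closure (Subgroup.zpowers γ : Set ℤ_[p]ˣ) ⊆
      {u : ℤ_[p]ˣ | 2 * (p : ℤ_[p]) * p ∣ (u : ℤ_[p]) - 1} := by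
    refine closure_minimal ?_ (isClosed_setOf_dvd_sub_one _)
    rintro _ ⟨j, rfl⟩
    obtain ⟨u, hu⟩ := exists_unit_zpow_sub_one h.dvd j
    change 2 * (p : ℤ_[p]) * p ∣ ((γ ^ j : ℤ_[p]ˣ) : ℤ_[p]) - 1
    rw [hu, hc]
    exact (mul_dvd_mul_left _ hcu).mul_left _
  rw [h] at hsub
  have hun : IsUnit (1 + 2 * (p : ℤ_[p])) :=
    isUnit_of_dvd_sub isUnit_one ⟨2, by ring⟩
  have hmem := hsub (show hun.unit ∈ {u : ℤ_[p]ˣ | 2 * (p : ℤ_[p]) ∣ (u : ℤ_[p]) - 1} by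
    simp)
  simp only [Set.mem_ofPred_eq, IsUnit.unit_spec, add_sub_cancel_left] at hmem
  obtain ⟨e, he⟩ := hmem
  have h2p : 2 * (p : ℤ_[p]) ≠ 0 := mul_ne_zero two_ne_zero hp0
  have : (p : ℤ_[p]) * e = 1 := by
    apply mul_left_cancel₀ h2p
    linear_combination -he
  exact PadicInt.p_nonunit (p := p) (IsUnit.of_mul_eq_one _ this)

theorem valuation_unit_mul (u : ℤ_[p]ˣ) {x : ℤ_[p]} (hx : x ≠ 0) :
    ((u : ℤ_[p]) * x).valuation = x.valuation := by
  have hu : (u : ℤ_[p]).valuation = 0 := by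
    have h1 := PadicInt.valuation_mul (p := p) (x := u) (y := ((u⁻¹ : ℤ_[p]ˣ) : ℤ_[p]))
      u.ne_zero (u⁻¹).ne_zero
    rw [Units.mul_inv, PadicInt.valuation_one] at h1
    omega
  rw [PadicInt.valuation_mul u.ne_zero hx, hu, zero_add]

theorem valuation_intCast (j : ℤ) : (j : ℤ_[p]).valuation = padicValInt p j := by
  have h := Padic.valuation_intCast (p := p) j
  rw [← PadicInt.coe_intCast, PadicInt.valuation_coe] at h
  exact_mod_cast h

/-- The valuation of `w_{k_n} - w_{k_m}`, for `j = n - m` non-zero. -/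
def wgt (p : ℕ) (j : ℤ) : ℕ := (if p = 2 then 3 else 1) + padicValInt p j

theorem delta_pos : 0 < delta p := by
  have := (Fact.out : p.Prime).two_le
  unfold delta
  split_ifs <;> omega

theorem wgt_eq {j : ℤ} (hj : j ≠ 0) : padicValInt p (delta p * j * (2 * p)) = wgt p j := by
  have hp := (Fact.out : p.Prime)
  have hp0 : (p : ℤ) ≠ 0 := by exact_mod_cast hp.ne_zero
  rw [padicValInt.mul (mul_ne_zero delta_pos.ne' hj) (mul_ne_zero two_ne_zero hp0),
    padicValInt.mul delta_pos.ne' hj, padicValInt.mul two_ne_zero hp0, padicValInt_self]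
  unfold wgt delta
  rcases hp.eq_two_or_odd' with rfl | hodd
  · have : padicValInt 2 2 = 1 := padicValInt_self (p := 2)
    simp [this]
    ring
  · have hp2 : p ≠ 2 := by rintro rfl; exact absurd hodd (by decide)
    have h3 : 3 ≤ p := by have := hp.two_le; omega
    have e1 : padicValInt p ((p : ℤ) - 1) = 0 := by
      refine padicValInt.eq_zero_of_not_dvd fun h => ?_
      have := Int.le_of_dvd (by omega) h
      omega
    have e2 : padicValInt p 2 = 0 := by
      refine padicValInt.eq_zero_of_not_dvd fun h => ?_
      have := Int.le_of_dvd (by omega) h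
      omega
    simp [hp2, e1, e2]
    ring

/-- The exceptional normalization for `p = 2`, `k₀ = 1` only multiplies the difference by the unit
`γ⁻¹`. -/
theorem wtCoord_sub {γ : ℤ_[p]ˣ} (hγ : IsTopGen p γ) (k₀ n m : ℤ) :
    ∃ u : ℤ_[p]ˣ, wtCoord p k₀ γ n - wtCoord p k₀ γ m =
      u * ((delta p * (n - m) * (2 * p) : ℤ) : ℤ_[p]) := by
  obtain ⟨u, hu⟩ := hγ.exists_unit
  obtain ⟨v, hv⟩ := exists_unit_zpow_sub_one hγ.dvd (wt p k₀ n - wt p k₀ m)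
  have hpow : γ ^ wt p k₀ n = γ ^ wt p k₀ m * γ ^ (wt p k₀ n - wt p k₀ m) := by
    rw [← zpow_add]; congr 1; ring
  have e : wt p k₀ n - wt p k₀ m = delta p * (n - m) := by unfold wt; ring
  have main : ((γ ^ wt p k₀ n : ℤ_[p]ˣ) : ℤ_[p]) - ((γ ^ wt p k₀ m : ℤ_[p]ˣ) : ℤ_[p]) =
      ((γ ^ wt p k₀ m : ℤ_[p]ˣ) : ℤ_[p]) * v * u *
        ((delta p * (n - m) * (2 * p) : ℤ) : ℤ_[p]) := by
    rw [hpow, Units.val_mul]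
    rw [e] at hv ⊢
    rw [hu] at hv
    push_cast at hv ⊢
    linear_combination ((γ ^ wt p k₀ m : ℤ_[p]ˣ) : ℤ_[p]) * hv
  unfold wtCoord coord
  simp only [zpowGroupHom_apply]
  split_ifs
  · refine ⟨γ⁻¹ * (γ ^ wt p k₀ m * v * u), ?_⟩
    simp only [Units.val_mul] at main ⊢
    linear_combination ((γ⁻¹ : ℤ_[p]ˣ) : ℤ_[p]) * main
  · refine ⟨γ ^ wt p k₀ m * v * u, ?_⟩
    simp only [Units.val_mul] at main ⊢
    linear_combination main

theorem wtCoord_sub_ne_zero {γ : ℤ_[p]ˣ} (hγ : IsTopGen p γ) (k₀ : ℤ) {n m : ℤ} (h : n ≠ m) :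
    wtCoord p k₀ γ n - wtCoord p k₀ γ m ≠ 0 := by
  obtain ⟨u, hu⟩ := wtCoord_sub hγ k₀ n m
  rw [hu]
  refine mul_ne_zero u.ne_zero (Int.cast_ne_zero.mpr ?_)
  have hp0 : (p : ℤ) ≠ 0 := by exact_mod_cast (Fact.out : p.Prime).ne_zero
  exact mul_ne_zero (mul_ne_zero delta_pos.ne' (sub_ne_zero.mpr h)) (mul_ne_zero two_ne_zero hp0)

theorem valuation_wtCoord_sub {γ : ℤ_[p]ˣ} (hγ : IsTopGen p γ) (k₀ : ℤ) {n m : ℤ} (h : n ≠ m) :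
    (wtCoord p k₀ γ n - wtCoord p k₀ γ m).valuation = wgt p (n - m) := by
  obtain ⟨u, hu⟩ := wtCoord_sub hγ k₀ n m
  have h0 := wtCoord_sub_ne_zero hγ k₀ h
  rw [hu] at h0 ⊢
  rw [valuation_unit_mul u (right_ne_zero_of_mul h0), valuation_intCast,
    wgt_eq (sub_ne_zero.mpr h)]

theorem valuation_prod {ι : Type*} (s : Finset ι) (f : ι → ℤ_[p]) (h : ∀ i ∈ s, f i ≠ 0) :
    (∏ i ∈ s, f i).valuation = ∑ i ∈ s, (f i).valuation := by
  classical
  induction s using Finset.induction_on with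
  | empty => simp
  | insert a s ha ih =>
    rw [Finset.prod_insert ha, Finset.sum_insert ha, PadicInt.valuation_mul (h a (by simp))
      (Finset.prod_ne_zero_iff.mpr fun i hi => h i (by simp [hi])),
      ih fun i hi => h i (by simp [hi])]

theorem coeff_seriesAt {d dnew : ℤ → ℤ} (k₀ : ℤ) (γ : ℤ_[p]ˣ) (n : ℤ) (i : ℕ) (s : Finset ℤ)
    (hs : ∀ m, mult d dnew i m ≠ 0 → m ∈ s) :
    PowerSeries.coeff i (seriesAt p d dnew k₀ γ n) =
      ∏ m ∈ s, (wtCoord p k₀ γ n - wtCoord p k₀ γ m) ^ mult d dnew i m := by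
  unfold seriesAt series coeff
  rw [PowerSeries.coeff_map, PowerSeries.coeff_mk, finprod_eq_prod_of_mulSupport_subset (s := s)]
  · simp
  · intro m hm
    refine hs m fun h0 => hm ?_
    simp [h0]

theorem coeff_seriesAt_ne_zero_iff {d dnew : ℤ → ℤ} (k₀ : ℤ) {γ : ℤ_[p]ˣ} (hγ : IsTopGen p γ)
    (n : ℤ) (i : ℕ) (s : Finset ℤ) (hs : ∀ m, mult d dnew i m ≠ 0 → m ∈ s) :
    PowerSeries.coeff i (seriesAt p d dnew k₀ γ n) ≠ 0 ↔ mult d dnew i n = 0 := by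
  rw [coeff_seriesAt k₀ γ n i s hs, Finset.prod_ne_zero_iff]
  constructor
  · intro h
    by_contra hn
    exact h n (hs n hn) (by simp [hn])
  · intro h m _
    by_cases hm : m = n
    · subst hm
      simp [h]
    · exact pow_ne_zero _ (wtCoord_sub_ne_zero hγ k₀ (Ne.symm hm))

theorem valuation_coeff_seriesAt {d dnew : ℤ → ℤ} (k₀ : ℤ) {γ : ℤ_[p]ˣ} (hγ : IsTopGen p γ)
    (n : ℤ) (i : ℕ) (s : Finset ℤ) (hs : ∀ m, mult d dnew i m ≠ 0 → m ∈ s)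
    (hn : mult d dnew i n = 0) :
    (PowerSeries.coeff i (seriesAt p d dnew k₀ γ n)).valuation =
      ∑ m ∈ s, mult d dnew i m * wgt p (n - m) := by
  have h0 := (coeff_seriesAt_ne_zero_iff k₀ hγ n i s hs).mpr hn
  rw [coeff_seriesAt k₀ γ n i s hs] at h0 ⊢
  rw [valuation_prod _ _ (Finset.prod_ne_zero_iff.mp h0)]
  refine Finset.sum_congr rfl fun m _ => ?_
  rw [PadicInt.valuation_pow]
  by_cases hm : m = n
  · subst hm
    simp [hn]
  · rw [valuation_wtCoord_sub hγ k₀ (Ne.symm hm)]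

end Ghost

/-! ### Bookkeeping of logarithmic errors. -/

/-- The shift by `2` keeps logarithms at least `log 2` for nonnegative arguments, so that additive
constants are absorbed into a multiple of the logarithm. -/
theorem log_add_two_le {D y x : ℝ} (hD : 0 ≤ D) (hx : 0 ≤ x) (hy : 0 ≤ y)
    (h : y ≤ D * (x + 1)) :
    Real.log (y + 2) ≤ (Real.log (D + 2) / Real.log 2 + 1) * Real.log (x + 2) := by
  have hl2 : 0 < Real.log 2 := Real.log_pos one_lt_two
  have h1 : Real.log (y + 2) ≤ Real.log ((D + 2) * (x + 2)) :=
    Real.log_le_log (by linarith) (by nlinarith)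
  rw [Real.log_mul (by linarith) (by linarith)] at h1
  have h2 : Real.log 2 ≤ Real.log (x + 2) := Real.log_le_log two_pos (by linarith)
  have h3 : 0 ≤ Real.log (D + 2) := Real.log_nonneg (by linarith)
  have h4 : Real.log (D + 2) ≤ Real.log (D + 2) / Real.log 2 * Real.log (x + 2) := by
    rw [div_mul_eq_mul_div, le_div_iff₀ hl2]
    exact mul_le_mul_of_nonneg_left h2 h3
  linarith

theorem le_mul_log_add_two {c x : ℝ} (hc : 0 ≤ c) (hx : 0 ≤ x) :
    c ≤ c / Real.log 2 * Real.log (x + 2) := by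
  have hl2 : 0 < Real.log 2 := Real.log_pos one_lt_two
  have h2 : Real.log 2 ≤ Real.log (x + 2) := Real.log_le_log two_pos (by linarith)
  rw [div_mul_eq_mul_div, le_div_iff₀ hl2]
  exact mul_le_mul_of_nonneg_left h2 hc

theorem log_add_two_pos {x : ℝ} (hx : 0 ≤ x) : 0 < Real.log (x + 2) :=
  Real.log_pos (by linarith)

theorem natLog_le_log_add_two {p : ℕ} (hp : 2 ≤ p) (N : ℕ) :
    (Nat.log p N : ℝ) ≤ 1 / Real.log 2 * Real.log ((N : ℝ) + 2) := by
  have hl2 : 0 < Real.log 2 := Real.log_pos one_lt_two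
  rcases Nat.eq_zero_or_pos N with rfl | hN
  · have := log_add_two_pos (le_refl (0 : ℝ))
    simp only [Nat.log_zero_right, Nat.cast_zero]
    positivity
  · have h1 : (Nat.log p N : ℝ) ≤ Nat.log 2 N := by
      exact_mod_cast Nat.log_anti_left one_lt_two hp
    have h2 : (Nat.log 2 N : ℝ) ≤ Real.logb 2 N := by
      exact_mod_cast Real.natLog_le_logb N 2
    have h3 : Real.log N ≤ Real.log ((N : ℝ) + 2) :=
      Real.log_le_log (by exact_mod_cast hN) (by linarith)
    refine (h1.trans h2).trans ?_
    rw [Real.logb, one_div, div_eq_inv_mul]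
    exact mul_le_mul_of_nonneg_left h3 (by positivity)

/-! ### The mean of the `p`-adic valuation over intervals. -/

namespace Ghost

variable {p : ℕ} [Fact p.Prime]

/-- Legendre's formula: the error is the base-`p` digit sum of `N` divided by `p - 1`, hence at most
the number of digits. -/
theorem abs_padicValNat_factorial_sub_le (N : ℕ) :
    |(padicValNat p N.factorial : ℝ) - N / ((p : ℝ) - 1)| ≤
      2 / Real.log 2 * Real.log ((N : ℝ) + 2) := by
  have hp := (Fact.out : p.Prime).two_le
  have hp1 : (0 : ℝ) < (p : ℝ) - 1 := by
    have : (2 : ℝ) ≤ p := by exact_mod_cast hp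
    linarith
  have hle := Nat.digit_sum_le p N
  have h := sub_one_mul_padicValNat_factorial (p := p) N
  have h' : ((p : ℝ) - 1) * padicValNat p N.factorial = N - (p.digits N).sum := by
    have := congrArg (Nat.cast : ℕ → ℝ) h
    rw [Nat.cast_sub hle, Nat.cast_mul, Nat.cast_sub (by omega)] at this
    simpa using this
  have hs : (p.digits N).sum ≤ (Nat.log p N + 1) * (p - 1) := by
    have h1 := List.sum_le_card_nsmul (p.digits N) (p - 1) fun x hx => by
      have := Nat.digits_lt_base (by omega) hx
      omega
    refine h1.trans ?_
    rw [smul_eq_mul]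
    refine Nat.mul_le_mul_right _ ?_
    rcases Nat.eq_zero_or_pos N with rfl | hN
    · simp
    · rw [Nat.length_digits p N (by omega) hN.ne']
  have hs' : ((p.digits N).sum : ℝ) ≤ (Nat.log p N + 1) * ((p : ℝ) - 1) := by
    have : ((p - 1 : ℕ) : ℝ) = (p : ℝ) - 1 := by rw [Nat.cast_sub (by omega)]; simp
    rw [← this]
    exact_mod_cast hs
  have e : (padicValNat p N.factorial : ℝ) - N / ((p : ℝ) - 1) =
      -((p.digits N).sum / ((p : ℝ) - 1)) := by
    field_simp
    linarith
  rw [e, abs_neg, abs_of_nonneg (by positivity)]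
  have h1 : ((p.digits N).sum : ℝ) / ((p : ℝ) - 1) ≤ Nat.log p N + 1 := by
    rwa [div_le_iff₀ hp1]
  have h2 := natLog_le_log_add_two hp N
  have h3 := le_mul_log_add_two zero_le_one (Nat.cast_nonneg (α := ℝ) N)
  have e2 : 2 / Real.log 2 * Real.log ((N : ℝ) + 2) =
    1 / Real.log 2 * Real.log ((N : ℝ) + 2) + 1 / Real.log 2 * Real.log ((N : ℝ) + 2) := by ring
  linarith

/-- A primitive, for the forward difference, of the `p`-adic valuation on `ℤ`. -/
noncomputable def valPrim (p : ℕ) (t : ℤ) : ℝ :=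
  if 1 ≤ t then (padicValNat p (t - 1).toNat.factorial : ℝ)
  else -(padicValNat p (-t).toNat.factorial : ℝ)

theorem valPrim_succ_sub (t : ℤ) : valPrim p (t + 1) - valPrim p t = padicValInt p t := by
  have hfac : ∀ k : ℕ, (padicValNat p (k + 1).factorial : ℝ) =
      padicValNat p (k + 1) + padicValNat p k.factorial := by
    intro k
    rw [Nat.factorial_succ, padicValNat.mul (by omega) (Nat.factorial_ne_zero k)]
    push_cast
    ring
  obtain ⟨k, rfl | rfl⟩ := t.eq_nat_or_neg
  · rcases k with - | k
    -- At `t = 0` both values of the primitive are `0`, matching the convention that `0` has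
    -- `padicValInt` equal to `0`. Intervals containing `m = n` thus need no special treatment.
    · simp [valPrim]
    · have e1 : ((k + 1 : ℕ) + 1 - 1 : ℤ).toNat = k + 1 := by omega
      have e2 : ((k + 1 : ℕ) - 1 : ℤ).toNat = k := by omega
      rw [valPrim, valPrim, if_pos (by omega), if_pos (by omega), e1, e2, hfac, padicValInt,
        Int.natAbs_natCast]
      ring
  · rcases k with - | k
    · simp [valPrim]
    · have e1 : (-(-((k + 1 : ℕ) : ℤ) + 1)).toNat = k := by omega
      have e2 : (-(-((k + 1 : ℕ) : ℤ))).toNat = k + 1 := by omega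
      rw [valPrim, valPrim, if_neg (by omega), if_neg (by omega), e1, e2, hfac, padicValInt,
        Int.natAbs_neg, Int.natAbs_natCast]
      ring

theorem abs_valPrim_sub_le (t : ℤ) :
    |valPrim p t - t / ((p : ℝ) - 1)| ≤ 3 / Real.log 2 * Real.log (|(t : ℝ)| + 2) := by
  have hl2 : 0 < Real.log 2 := Real.log_pos one_lt_two
  have hp : (2 : ℝ) ≤ p := by exact_mod_cast (Fact.out : p.Prime).two_le
  have hp1 : (0 : ℝ) < (p : ℝ) - 1 := by linarith
  have h3 := le_mul_log_add_two zero_le_one (abs_nonneg (t : ℝ))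
  have h4 : 1 / ((p : ℝ) - 1) ≤ 1 := by rw [div_le_one hp1]; linarith
  have h5 : 0 ≤ 1 / ((p : ℝ) - 1) := by positivity
  have e3 : 3 / Real.log 2 * Real.log (|(t : ℝ)| + 2) =
    2 / Real.log 2 * Real.log (|(t : ℝ)| + 2) + 1 / Real.log 2 * Real.log (|(t : ℝ)| + 2) := by
    ring
  have hmono : ∀ N : ℕ, (N : ℝ) ≤ |(t : ℝ)| →
      2 / Real.log 2 * Real.log ((N : ℝ) + 2) ≤ 2 / Real.log 2 * Real.log (|(t : ℝ)| + 2) := by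
    intro N hN
    refine mul_le_mul_of_nonneg_left (Real.log_le_log (by positivity) (by linarith))
      (by positivity)
  unfold valPrim
  split_ifs with ht
  · obtain ⟨k, hk⟩ := Int.eq_ofNat_of_zero_le (show 0 ≤ t - 1 by omega)
    have ht' : (t : ℝ) = k + 1 := by
      have : t = k + 1 := by omega
      rw [this]; push_cast; ring
    have h1 := abs_padicValNat_factorial_sub_le (p := p) k
    have h2 := hmono k (by rw [ht', abs_of_nonneg (by positivity)]; linarith)
    rw [hk, Int.toNat_natCast]
    have e : (padicValNat p k.factorial : ℝ) - t / ((p : ℝ) - 1) =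
      ((padicValNat p k.factorial : ℝ) - k / ((p : ℝ) - 1)) - 1 / ((p : ℝ) - 1) := by
      rw [ht']; ring
    rw [e, e3]
    rw [abs_le] at h1 ⊢
    constructor <;> linarith
  · obtain ⟨k, hk⟩ := Int.eq_ofNat_of_zero_le (show 0 ≤ -t by omega)
    have ht' : (t : ℝ) = -k := by
      have : t = -k := by omega
      rw [this]; push_cast; ring
    have h1 := abs_padicValNat_factorial_sub_le (p := p) k
    have h2 := hmono k (by rw [ht', abs_neg, abs_of_nonneg (by positivity)])
    rw [hk, Int.toNat_natCast]
    have e : -(padicValNat p k.factorial : ℝ) - t / ((p : ℝ) - 1) =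
      -((padicValNat p k.factorial : ℝ) - k / ((p : ℝ) - 1)) := by
      rw [ht']; ring
    rw [e, e3, abs_neg]
    linarith

theorem padicValInt_le_log (j : ℤ) :
    (padicValInt p j : ℝ) ≤ 1 / Real.log 2 * Real.log (|(j : ℝ)| + 2) := by
  have h1 : (padicValInt p j : ℝ) ≤ Nat.log p j.natAbs := by
    exact_mod_cast padicValNat_le_nat_log _
  have h2 := natLog_le_log_add_two (Fact.out : p.Prime).two_le j.natAbs
  rw [Nat.cast_natAbs, Int.cast_abs] at h2
  exact h1.trans h2

theorem sum_Ico_padicValInt (n : ℤ) {a b : ℤ} (hab : a ≤ b) :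
    ∑ m ∈ Finset.Ico a b, (padicValInt p (n - m) : ℝ) =
      valPrim p (n - a + 1) - valPrim p (n - b + 1) := by
  induction b, hab using Int.leInduction with
  | base => simp
  | succ b hab ih =>
    have : Finset.Ico a (b + 1) = insert b (Finset.Ico a b) := by
      ext x; simp only [Finset.mem_Ico, Finset.mem_insert]; omega
    rw [this, Finset.sum_insert (by simp), ih, ← valPrim_succ_sub, show n - (b + 1) + 1 = n - b by
      ring]
    ring

/-- The average of `wgt p` over long intervals. -/
noncomputable def avgWgt (p : ℕ) : ℝ := (if p = 2 then 3 else 1) + 1 / ((p : ℝ) - 1)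

theorem avgWgt_pos : 0 < avgWgt p := by
  have hp : (2 : ℝ) ≤ p := by exact_mod_cast (Fact.out : p.Prime).two_le
  have hp1 : (0 : ℝ) < (p : ℝ) - 1 := by linarith
  unfold avgWgt
  split_ifs <;> positivity

theorem abs_sum_Ico_wgt_sub_le (n : ℤ) {a b : ℤ} (hab : a ≤ b) :
    |∑ m ∈ Finset.Ico a b, (wgt p (n - m) : ℝ) - avgWgt p * (b - a)| ≤
      3 / Real.log 2 * (Real.log (|((n - a + 1 : ℤ) : ℝ)| + 2) +
        Real.log (|((n - b + 1 : ℤ) : ℝ)| + 2)) := by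
  have h1 := abs_valPrim_sub_le (p := p) (n - a + 1)
  have h2 := abs_valPrim_sub_le (p := p) (n - b + 1)
  have hcard : ((Finset.Ico a b).card : ℝ) = b - a := by
    have h := Int.card_Ico_of_le _ _ hab
    have : (((Finset.Ico a b).card : ℤ) : ℝ) = ((b - a : ℤ) : ℝ) := by rw [h]
    push_cast at this
    exact this
  have e : ∑ m ∈ Finset.Ico a b, (wgt p (n - m) : ℝ) - avgWgt p * (b - a) =
      (valPrim p (n - a + 1) - ((n - a + 1 : ℤ) : ℝ) / ((p : ℝ) - 1)) -
      (valPrim p (n - b + 1) - ((n - b + 1 : ℤ) : ℝ) / ((p : ℝ) - 1)) := by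
    simp only [wgt, Nat.cast_add, Finset.sum_add_distrib, sum_Ico_padicValInt n hab,
      Finset.sum_const, nsmul_eq_mul, hcard, avgWgt]
    push_cast
    ring
  rw [e, mul_add]
  exact (abs_sub _ _).trans (add_le_add h1 h2)

end Ghost

/-! ### Linear growth of the increments of the weighted multiplicities. -/

namespace Ghost

variable {p : ℕ} [Fact p.Prime]

theorem exists_wgt_le (m : ℤ) : ∃ C : ℝ, 0 ≤ C ∧ ∀ n x : ℤ, 0 ≤ n → 0 ≤ x →
    (wgt p (n - m) : ℝ) ≤ C * Real.log ((n : ℝ) + x + 2) := by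
  have hl2 : 0 < Real.log 2 := Real.log_pos one_lt_two
  set D : ℝ := |(m : ℝ)| + 1 with hD
  have hD0 : 0 ≤ D := by positivity
  set c : ℝ := if p = 2 then 3 else 1 with hc
  have hc0 : 0 ≤ c := by rw [hc]; split_ifs <;> norm_num
  have hlD : 0 ≤ Real.log (D + 2) := Real.log_nonneg (by linarith)
  refine ⟨c / Real.log 2 + 1 / Real.log 2 * (Real.log (D + 2) / Real.log 2 + 1), by positivity,
    fun n x hn hx => ?_⟩
  have hn' : (0 : ℝ) ≤ n := by exact_mod_cast hn
  have hx' : (0 : ℝ) ≤ x := by exact_mod_cast hx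
  have h1 := padicValInt_le_log (p := p) (n - m)
  have h2 : Real.log (|((n - m : ℤ) : ℝ)| + 2) ≤ _ :=
    log_add_two_le (x := (n : ℝ) + x) hD0 (by positivity) (abs_nonneg _) (by
      push_cast
      have := abs_sub (n : ℝ) m
      rw [abs_of_nonneg hn'] at this
      nlinarith [abs_nonneg (m : ℝ)])
  have h3 := le_mul_log_add_two hc0 (add_nonneg hn' hx')
  have h4 := mul_le_mul_of_nonneg_left h2 (by positivity : 0 ≤ 1 / Real.log 2)
  have e : (wgt p (n - m) : ℝ) = c + padicValInt p (n - m) := by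
    rw [wgt, hc]; push_cast; rfl
  rw [e]
  linarith

theorem exists_sum_Ico_wgt (lam K : ℝ) (hlam : 0 < lam) (hK : 0 ≤ K) (a : ℤ) :
    ∃ C : ℝ, 0 ≤ C ∧ ∀ n x b : ℤ, 0 ≤ n → 0 ≤ x → a ≤ b → (b : ℝ) ≤ |(a : ℝ)| + (x + K) / lam + 1 →
      |∑ m ∈ Finset.Ico a b, (wgt p (n - m) : ℝ) - avgWgt p * (b - a)| ≤
        C * Real.log ((n : ℝ) + x + 2) := by
  have hl2 : 0 < Real.log 2 := Real.log_pos one_lt_two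
  set D : ℝ := |(a : ℝ)| + 1 / lam + K / lam + 2 with hD
  have hD0 : 0 ≤ D := by positivity
  have hlD : 0 ≤ Real.log (D + 2) := Real.log_nonneg (by linarith)
  refine ⟨3 / Real.log 2 * (2 * (Real.log (D + 2) / Real.log 2 + 1)), by positivity,
    fun n x b hn hx hab hb => ?_⟩
  have hn' : (0 : ℝ) ≤ n := by exact_mod_cast hn
  have hx' : (0 : ℝ) ≤ x := by exact_mod_cast hx
  have key : ∀ t : ℤ, |(t : ℝ)| ≤ |(a : ℝ)| + (x + K) / lam + 1 →
      Real.log (|((n - t + 1 : ℤ) : ℝ)| + 2) ≤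
        (Real.log (D + 2) / Real.log 2 + 1) * Real.log ((n : ℝ) + x + 2) := by
    intro t ht
    refine log_add_two_le hD0 (by positivity) (abs_nonneg _) ?_
    push_cast
    have h1 : |(n : ℝ) - t + 1| ≤ n + |(t : ℝ)| + 1 := by
      rw [abs_le]
      constructor <;> nlinarith [abs_le.mp (le_refl |(t : ℝ)|)]
    have e : (x + K) / lam = x * (1 / lam) + K / lam := by field_simp
    rw [e] at ht
    have q1 : 0 ≤ 1 / lam := by positivity
    have q2 : 0 ≤ K / lam := by positivity
    have q3 := abs_nonneg (a : ℝ)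
    have q4 : 0 ≤ |(a : ℝ)| * (n + x) := by positivity
    have q5 : 0 ≤ 1 / lam * (n + 1) := by positivity
    have q6 : 0 ≤ K / lam * (n + x) := by positivity
    rw [hD]
    nlinarith
  have hb' : |(b : ℝ)| ≤ |(a : ℝ)| + (x + K) / lam + 1 := by
    have hab' : (a : ℝ) ≤ b := by exact_mod_cast hab
    have q : 0 ≤ (x + K) / lam := by positivity
    rw [abs_le]
    exact ⟨by linarith [neg_abs_le (a : ℝ)], hb⟩
  have ha' : |(a : ℝ)| ≤ |(a : ℝ)| + (x + K) / lam + 1 := by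
    have q : 0 ≤ (x + K) / lam := by positivity
    linarith
  refine (abs_sum_Ico_wgt_sub_le n hab).trans ?_
  rw [mul_assoc]
  refine mul_le_mul_of_nonneg_left ?_ (by positivity)
  linarith [key a ha', key b hb']

/-- The total weight of the `m ≥ a` with `F m ≤ x`, for a function `F` of linear growth. -/
theorem exists_sum_filter_wgt (F : ℤ → ℤ) (lam K : ℝ) (hlam : 0 < lam) (hK : 0 ≤ K) (a : ℤ)
    (hF : ∀ m, a ≤ m → |(F m : ℝ) - lam * m| ≤ K) :
    ∃ C : ℝ, 0 ≤ C ∧ ∀ n x R : ℤ, 0 ≤ n → 0 ≤ x → (∀ m, R ≤ m → x < F m) →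
      |∑ m ∈ Finset.Ico a R, (if F m ≤ x then (wgt p (n - m) : ℝ) else 0) -
        avgWgt p * (x / lam)| ≤ C * Real.log ((n : ℝ) + x + 2) := by
  have hl2 : 0 < Real.log 2 := Real.log_pos one_lt_two
  obtain ⟨C, hC0, hC⟩ := exists_sum_Ico_wgt (p := p) lam K hlam hK a
  have hav := avgWgt_pos (p := p)
  set E : ℝ := avgWgt p * (K / lam + 2 * |(a : ℝ)| + 1) with hE
  have hE0 : 0 ≤ E := by positivity
  refine ⟨C + E / Real.log 2, by positivity, fun n x R hn hx hR => ?_⟩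
  have hn' : (0 : ℝ) ≤ n := by exact_mod_cast hn
  have hx' : (0 : ℝ) ≤ x := by exact_mod_cast hx
  have hEl := le_mul_log_add_two hE0 (add_nonneg hn' hx')
  have hK' : 0 ≤ K / lam := by positivity
  have hxl : 0 ≤ x / lam := by positivity
  rw [← Finset.sum_filter]
  have hadd : (x + K) / lam = x / lam + K / lam := add_div _ _ _
  have hsub : (x - K) / lam = x / lam - K / lam := sub_div _ _ _
  have habs := neg_abs_le (a : ℝ)
  have habs' := le_abs_self (a : ℝ)
  rw [abs_le]
  constructor
  -- `F` need not be monotone, so the set where `F m ≤ x` is sandwiched between two intervals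
  -- starting at `a`. Here every `m ≥ a` with `lam * m ≤ x - K` belongs to it; the other half uses
  -- that its members satisfy `lam * m ≤ x + K`.
  · set b := max a (⌊(x - K) / lam⌋ + 1) with hb
    have hbu : (b : ℝ) ≤ |(a : ℝ)| + (x + K) / lam + 1 := by
      rw [hb]
      push_cast
      refine max_le (by linarith) ?_
      have := Int.floor_le ((x - K) / lam)
      linarith [abs_nonneg (a : ℝ)]
    have hbl : (x - K) / lam ≤ b := by
      have h1 : ((⌊(x - K) / lam⌋ + 1 : ℤ) : ℝ) ≤ b := by exact_mod_cast le_max_right _ _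
      have h2 := Int.lt_floor_add_one ((x - K) / lam)
      push_cast at h1
      linarith
    have hsum : ∑ m ∈ Finset.Ico a b, (wgt p (n - m) : ℝ) ≤
        ∑ m ∈ (Finset.Ico a R).filter (fun m => F m ≤ x), (wgt p (n - m) : ℝ) := by
      refine Finset.sum_le_sum_of_subset_of_nonneg ?_ fun _ _ _ => Nat.cast_nonneg _
      intro m hm
      obtain ⟨h1, h2⟩ := Finset.mem_Ico.mp hm
      have h3 : m ≤ ⌊(x - K) / lam⌋ := by
        rcases lt_max_iff.mp h2 with h | h <;> omega
      have h4 := Int.le_floor.mp h3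
      rw [le_div_iff₀ hlam] at h4
      have h5 := (abs_le.mp (hF m h1)).2
      have h6 : F m ≤ x := by
        have : (F m : ℝ) ≤ x := by linarith
        exact_mod_cast this
      refine Finset.mem_filter.mpr ⟨Finset.mem_Ico.mpr ⟨h1, ?_⟩, h6⟩
      by_contra! hRm
      exact absurd (hR m hRm) (not_lt.mpr h6)
    have h7 := (abs_le.mp (hC n x b hn hx (le_max_left _ _) hbu)).1
    have h8 : avgWgt p * (x / lam) - E ≤ avgWgt p * (b - a) := by
      rw [hE, ← mul_sub]
      refine mul_le_mul_of_nonneg_left ?_ hav.le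
      linarith
    linarith
  · set b := max a (⌊(x + K) / lam⌋ + 1) with hb
    have hxK : 0 ≤ (x + K) / lam := by positivity
    have hbu : (b : ℝ) ≤ |(a : ℝ)| + (x + K) / lam + 1 := by
      rw [hb]
      push_cast
      refine max_le (by linarith) ?_
      have := Int.floor_le ((x + K) / lam)
      linarith [abs_nonneg (a : ℝ)]
    have hsum : ∑ m ∈ (Finset.Ico a R).filter (fun m => F m ≤ x), (wgt p (n - m) : ℝ) ≤
        ∑ m ∈ Finset.Ico a b, (wgt p (n - m) : ℝ) := by
      refine Finset.sum_le_sum_of_subset_of_nonneg ?_ fun _ _ _ => Nat.cast_nonneg _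
      intro m hm
      obtain ⟨h1, h6⟩ := Finset.mem_filter.mp hm
      obtain ⟨h1, -⟩ := Finset.mem_Ico.mp h1
      have h5 := (abs_le.mp (hF m h1)).1
      have h6' : (F m : ℝ) ≤ x := by exact_mod_cast h6
      have h4 : m ≤ ⌊(x + K) / lam⌋ := by
        rw [Int.le_floor, le_div_iff₀ hlam]
        linarith
      exact Finset.mem_Ico.mpr ⟨h1, lt_max_iff.mpr (Or.inr (by omega))⟩
    have h7 := (abs_le.mp (hC n x b hn hx (le_max_left _ _) hbu)).2
    have h8 : avgWgt p * (b - a) ≤ avgWgt p * (x / lam) + E := by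
      rw [hE, ← mul_add]
      refine mul_le_mul_of_nonneg_left ?_ hav.le
      linarith
    linarith

/-- The increment of the tent is `1` going up, `-1` coming down and `0` outside. The two middle
thresholds handle parity: for even `dnew m` they switch on together, for odd `dnew m` one step
apart, leaving an increment `0` at the flat top. -/
theorem mult_sub_mult_pred {d dnew : ℤ → ℤ} {m : ℤ} (hm : 0 ≤ dnew m) (i : ℤ) :
    ((mult d dnew i m : ℤ) : ℤ) - mult d dnew (i - 1) m =
      (if d m + 1 ≤ i then 1 else 0) - (if 2 * d m + dnew m + 1 ≤ 2 * i then 1 else 0) -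
      (if 2 * d m + dnew m + 2 ≤ 2 * i then 1 else 0) +
      (if d m + dnew m + 1 ≤ i then 1 else 0) := by
  unfold mult
  split_ifs <;> omega

/-- Without a sign condition on `dnew`, this covers the finitely many `m` that come before the
linear growth sets in. -/
theorem abs_mult_sub_mult_pred_le (d dnew : ℤ → ℤ) (m i : ℤ) :
    |(mult d dnew i m : ℤ) - mult d dnew (i - 1) m| ≤ 1 := by
  rw [abs_le]
  unfold mult
  split_ifs <;> constructor <;> omega

theorem mult_eq_zero {d dnew : ℤ → ℤ} {m i : ℤ} (h : i ≤ d m ∨ d m + dnew m ≤ i) :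
    mult d dnew i m = 0 := by
  unfold mult
  split_ifs <;> omega

/-- The increments of `i ↦ ∑ mult i m * wgt (n - m)` grow linearly, up to a logarithm. -/
theorem exists_sum_increment (d dnew : ℤ → ℤ) (A B K : ℝ) (hA : 0 < A) (hB : 0 < B) (hK : 0 ≤ K)
    (a₀ a : ℤ) (ha : a₀ ≤ a)
    (hd : ∀ m, a ≤ m → |(d m : ℝ) - A * m| ≤ K) (hd' : ∀ m, a ≤ m → |(dnew m : ℝ) - B * m| ≤ K)
    (hpos : ∀ m, a ≤ m → 0 ≤ dnew m) :
    ∃ C : ℝ, 0 ≤ C ∧ ∀ n i R : ℤ, 0 ≤ n → 1 ≤ i → a ≤ R → (∀ m, R ≤ m → i ≤ d m) →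
      |∑ m ∈ Finset.Ico a₀ R, ((mult d dnew i m : ℝ) - mult d dnew (i - 1) m) * wgt p (n - m) -
        avgWgt p * (B ^ 2 / (A * (A + B) * (2 * A + B))) * i| ≤
        C * Real.log ((n : ℝ) + i + 2) := by
  have hl2 : 0 < Real.log 2 := Real.log_pos one_lt_two
  have hl3 : 0 < Real.log (2 + 2) := Real.log_pos (by norm_num)
  obtain ⟨C1, hC10, hC1⟩ := exists_sum_filter_wgt (p := p) (fun m => d m + 1) A (3 * K + 2) hA
    (by linarith) a (fun m hm => by
      have h1 := abs_le.mp (hd m hm)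
      rw [abs_le]; push_cast; constructor <;> linarith)
  obtain ⟨C2, hC20, hC2⟩ := exists_sum_filter_wgt (p := p) (fun m => 2 * d m + dnew m + 1)
    (2 * A + B) (3 * K + 2) (by linarith) (by linarith) a (fun m hm => by
      have h1 := abs_le.mp (hd m hm)
      have h2 := abs_le.mp (hd' m hm)
      rw [abs_le]; push_cast; constructor <;> linarith)
  obtain ⟨C3, hC30, hC3⟩ := exists_sum_filter_wgt (p := p) (fun m => 2 * d m + dnew m + 2)
    (2 * A + B) (3 * K + 2) (by linarith) (by linarith) a (fun m hm => by
      have h1 := abs_le.mp (hd m hm)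
      have h2 := abs_le.mp (hd' m hm)
      rw [abs_le]; push_cast; constructor <;> linarith)
  obtain ⟨C4, hC40, hC4⟩ := exists_sum_filter_wgt (p := p) (fun m => d m + dnew m + 1)
    (A + B) (3 * K + 2) (by linarith) (by linarith) a (fun m hm => by
      have h1 := abs_le.mp (hd m hm)
      have h2 := abs_le.mp (hd' m hm)
      rw [abs_le]; push_cast; constructor <;> linarith)
  choose Cw hCw0 hCw using exists_wgt_le (p := p)
  set C5 := ∑ m ∈ Finset.Ico a₀ a, Cw m with hC5
  have hC50 : 0 ≤ C5 := Finset.sum_nonneg fun m _ => hCw0 m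
  set Q := Real.log (2 + 2) / Real.log 2 + 1 with hQ
  have hQ0 : 0 ≤ Q := by positivity
  refine ⟨C1 + C2 * Q + C3 * Q + C4 + C5, by positivity, fun n i R hn hi haR hR => ?_⟩
  have hn' : (0 : ℝ) ≤ n := by exact_mod_cast hn
  have hi' : (1 : ℝ) ≤ i := by exact_mod_cast hi
  have hpos' : ∀ m, R ≤ m → 0 ≤ dnew m := fun m hm => hpos m (haR.trans hm)
  have b1 := hC1 n i R hn (by omega) fun m hm => by have := hR m hm; omega
  have b2 := hC2 n (2 * i) R hn (by omega) fun m hm => by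
    have := hR m hm; have := hpos' m hm; omega
  have b3 := hC3 n (2 * i) R hn (by omega) fun m hm => by
    have := hR m hm; have := hpos' m hm; omega
  have b4 := hC4 n i R hn (by omega) fun m hm => by
    have := hR m hm; have := hpos' m hm; omega
  have hlog : Real.log ((n : ℝ) + (2 * i : ℤ) + 2) ≤ Q * Real.log ((n : ℝ) + i + 2) := by
    refine log_add_two_le zero_le_two (by linarith) (by push_cast; linarith) ?_
    push_cast; linarith
  have b2' := b2.trans (mul_le_mul_of_nonneg_left hlog hC20)
  have b3' := b3.trans (mul_le_mul_of_nonneg_left hlog hC30)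
  -- The block below `a` has a fixed number of terms, each a weight of logarithmic size.
  have b5 : |∑ m ∈ Finset.Ico a₀ a,
      ((mult d dnew i m : ℝ) - mult d dnew (i - 1) m) * wgt p (n - m)| ≤
      C5 * Real.log ((n : ℝ) + i + 2) := by
    refine (Finset.abs_sum_le_sum_abs _ _).trans ?_
    rw [hC5, Finset.sum_mul]
    refine Finset.sum_le_sum fun m _ => ?_
    rw [abs_mul, abs_of_nonneg (Nat.cast_nonneg (α := ℝ) (wgt p (n - m)))]
    have h1 : |(mult d dnew i m : ℝ) - mult d dnew (i - 1) m| ≤ 1 := by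
      exact_mod_cast abs_mult_sub_mult_pred_le d dnew m i
    have h2 := hCw m n i hn (by omega)
    calc _ ≤ 1 * (wgt p (n - m) : ℝ) := mul_le_mul_of_nonneg_right h1 (Nat.cast_nonneg _)
      _ ≤ _ := by rw [one_mul]; exact h2
  have hsplit : Finset.Ico a₀ R = Finset.Ico a₀ a ∪ Finset.Ico a R :=
    (Finset.Ico_union_Ico_eq_Ico ha haR).symm
  have hmain : ∑ m ∈ Finset.Ico a R,
      ((mult d dnew i m : ℝ) - mult d dnew (i - 1) m) * wgt p (n - m) =
      ∑ m ∈ Finset.Ico a R, (if d m + 1 ≤ i then (wgt p (n - m) : ℝ) else 0) -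
      ∑ m ∈ Finset.Ico a R, (if 2 * d m + dnew m + 1 ≤ 2 * i then (wgt p (n - m) : ℝ) else 0) -
      ∑ m ∈ Finset.Ico a R, (if 2 * d m + dnew m + 2 ≤ 2 * i then (wgt p (n - m) : ℝ) else 0) +
      ∑ m ∈ Finset.Ico a R, (if d m + dnew m + 1 ≤ i then (wgt p (n - m) : ℝ) else 0) := by
    rw [← Finset.sum_sub_distrib, ← Finset.sum_sub_distrib, ← Finset.sum_add_distrib]
    refine Finset.sum_congr rfl fun m hm => ?_
    have h := congrArg (Int.cast : ℤ → ℝ)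
      (mult_sub_mult_pred (d := d) (hpos m (Finset.mem_Ico.mp hm).1) i)
    push_cast at h
    rw [h]
    split_ifs <;> ring
  -- The numerator is `(2A + B)² - 4A (A + B) = B²`.
  have halg : avgWgt p * (B ^ 2 / (A * (A + B) * (2 * A + B))) * i =
      avgWgt p * (i / A) - avgWgt p * ((2 * i : ℤ) / (2 * A + B)) -
      avgWgt p * ((2 * i : ℤ) / (2 * A + B)) + avgWgt p * (i / (A + B)) := by
    push_cast
    have q1 : A + B ≠ 0 := by positivity
    have q2 : 2 * A + B ≠ 0 := by positivity
    field_simp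
    ring
  rw [hsplit, Finset.sum_union (Finset.Ico_disjoint_Ico_consecutive a₀ a R), hmain, halg]
  rw [abs_le] at b1 b2' b3' b4 b5 ⊢
  constructor <;> linarith

end Ghost

/-! ### From increments of the height to slopes. -/

theorem sub_le_mul_of_forall_succ {f : ℕ → ℝ} {s : ℝ} {a b : ℕ} (hab : a ≤ b)
    (h : ∀ j, a ≤ j → j < b → f (j + 1) - f j ≤ s) : f b - f a ≤ s * ((b : ℝ) - a) := by
  induction b, hab using Nat.le_induction with
  | base => simp
  | succ b hab ih =>
    have h1 := ih fun j h1 h2 => h j h1 (by omega)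
    have h2 := h b hab (by omega)
    push_cast
    linarith

theorem exists_mul_log_one_add_le {C r : ℝ} (hC : 0 ≤ C) (hr : 0 < r) :
    ∃ c : ℝ, 0 ≤ c ∧ ∀ t : ℝ, 0 ≤ t → C * Real.log (1 + t) ≤ r * t + c := by
  set q := C / r + 1 with hq
  have hq1 : 1 ≤ q := by
    have : 0 ≤ C / r := by positivity
    linarith
  have hq0 : 0 < q := by linarith
  have hlq : 0 ≤ Real.log q := Real.log_nonneg hq1
  refine ⟨r + C * Real.log q, by positivity, fun t ht => ?_⟩
  have h1 := Real.log_le_sub_one_of_pos (show 0 < (1 + t) / q by positivity)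
  rw [Real.log_div (by positivity) hq0.ne'] at h1
  have h2 : Real.log (1 + t) ≤ (1 + t) / q + Real.log q := by linarith
  have h3 : C * ((1 + t) / q) ≤ r * (1 + t) := by
    rw [mul_div_assoc', div_le_iff₀ hq0]
    have : C ≤ r * q := by rw [hq, mul_add, mul_div_cancel₀ _ hr.ne']; linarith
    nlinarith
  have h4 := mul_le_mul_of_nonneg_left h2 hC
  linarith

theorem exists_abs_le_of_isBigO_one {f : ℤ → ℝ} (h : f =O[atTop] fun _ => (1 : ℝ)) :
    ∃ K : ℝ, 0 ≤ K ∧ ∀ᶠ n in atTop, |f n| ≤ K := by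
  obtain ⟨K, hK⟩ := h.bound
  refine ⟨max K 0, le_max_right _ _, hK.mono fun n hn => ?_⟩
  rw [Real.norm_eq_abs, norm_one, mul_one] at hn
  exact hn.trans (le_max_left _ _)

namespace Ghost

/-- The ordinate of the point of abscissa `i` attached to `G_{k_n}`, when there is one. -/
noncomputable def height (p : ℕ) (d dnew : ℤ → ℤ) (n i : ℤ) : ℝ :=
  ∑ᶠ m : ℤ, (mult d dnew i m : ℝ) * wgt p (n - m)

theorem height_eq_sum {p : ℕ} {d dnew : ℤ → ℤ} {n i : ℤ} {s : Finset ℤ}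
    (hs : ∀ m, mult d dnew i m ≠ 0 → m ∈ s) :
    height p d dnew n i = ∑ m ∈ s, (mult d dnew i m : ℝ) * wgt p (n - m) := by
  refine finsum_eq_sum_of_support_subset _ fun m hm => hs m fun h0 => hm ?_
  simp [h0]

variable {p : ℕ} [Fact p.Prime]

theorem mem_Ico_of_mult_ne_zero {d dnew : ℤ → ℤ} {a₀ R i : ℤ}
    (ha₀ : ∀ m < a₀, d m + dnew m ≤ 0) (hi : 0 ≤ i) (hR : ∀ m, R ≤ m → i ≤ d m) (m : ℤ)
    (hm : mult d dnew i m ≠ 0) : m ∈ Finset.Ico a₀ R := by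
  rw [Finset.mem_Ico]
  constructor
  · by_contra! h
    exact hm (mult_eq_zero (Or.inr ((ha₀ m h).trans hi)))
  · by_contra! h
    exact hm (mult_eq_zero (Or.inl (hR m h)))

/-- The constant is uniform in `n` and `i`, and the range where the coefficients of `G_{k_n}` vanish
is not excluded. There the term `m = n` enters with the finite weight `wgt p 0`. -/
theorem exists_height_increment {d dnew : ℤ → ℤ} (hG : Tendsto d atTop atTop)
    (hG' : Tendsto (fun n => d n + dnew n) atBot atBot) {A B : ℝ} (hA : 0 < A) (hB : 0 < B)
    (hLG : (fun n : ℤ => (d n : ℝ) - A * n) =O[atTop] fun _ => (1 : ℝ))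
    (hLG' : (fun n : ℤ => (dnew n : ℝ) - B * n) =O[atTop] fun _ => (1 : ℝ)) :
    ∃ C : ℝ, 0 ≤ C ∧ ∀ n i : ℤ, 0 ≤ n → 1 ≤ i →
      |height p d dnew n i - height p d dnew n (i - 1) -
        avgWgt p * (B ^ 2 / (A * (A + B) * (2 * A + B))) * i| ≤
        C * Real.log ((n : ℝ) + i + 2) := by
  obtain ⟨K₁, hK₁, h₁⟩ := exists_abs_le_of_isBigO_one hLG
  obtain ⟨K₂, hK₂, h₂⟩ := exists_abs_le_of_isBigO_one hLG'
  have hcast : Tendsto (fun n : ℤ => B * (n : ℝ)) atTop atTop :=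
    tendsto_intCast_atTop_atTop.const_mul_atTop hB
  obtain ⟨a, ha⟩ := eventually_atTop.mp (h₁.and (h₂.and (hcast.eventually_ge_atTop K₂)))
  obtain ⟨b, hb⟩ := eventually_atBot.mp (hG'.eventually_le_atBot 0)
  obtain ⟨C, hC0, hC⟩ := exists_sum_increment (p := p) d dnew A B (K₁ + K₂) hA hB (by positivity)
    (min a b) a (min_le_left _ _) (fun m hm => (ha m hm).1.trans (by linarith))
    (fun m hm => (ha m hm).2.1.trans (by linarith)) (fun m hm => by
      obtain ⟨-, h3, h4⟩ := ha m hm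
      have h5 : (0 : ℝ) ≤ dnew m := by linarith [(abs_le.mp h3).1]
      exact_mod_cast h5)
  refine ⟨C, hC0, fun n i hn hi => ?_⟩
  obtain ⟨R, hR⟩ := eventually_atTop.mp (hG.eventually_ge_atTop i)
  have hR' : ∀ m, max a R ≤ m → i ≤ d m := fun m hm => hR m ((le_max_right _ _).trans hm)
  have ha₀ : ∀ m < min a b, d m + dnew m ≤ 0 := fun m hm =>
    hb m (hm.le.trans (min_le_right _ _))
  have h := hC n i (max a R) hn hi (le_max_left _ _) hR'
  rw [height_eq_sum (mem_Ico_of_mult_ne_zero ha₀ (by omega) hR'),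
    height_eq_sum (mem_Ico_of_mult_ne_zero ha₀ (by omega : 0 ≤ i - 1) fun m hm => by
      have := hR' m hm; omega), ← Finset.sum_sub_distrib]
  simpa only [sub_mul] using h

theorem coeff_seriesAt_height {d dnew : ℤ → ℤ} (hG : Tendsto d atTop atTop)
    (hG' : Tendsto (fun n => d n + dnew n) atBot atBot) (k₀ : ℤ) {γ : ℤ_[p]ˣ}
    (hγ : IsTopGen p γ) (n : ℤ) (i : ℕ) :
    (PowerSeries.coeff i (seriesAt p d dnew k₀ γ n) ≠ 0 ↔ mult d dnew i n = 0) ∧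
    (mult d dnew i n = 0 →
      ((PowerSeries.coeff i (seriesAt p d dnew k₀ γ n)).valuation : ℝ) =
        height p d dnew n i) := by
  obtain ⟨b, hb⟩ := eventually_atBot.mp (hG'.eventually_le_atBot 0)
  obtain ⟨R, hR⟩ := eventually_atTop.mp (hG.eventually_ge_atTop (i : ℤ))
  have hs := mem_Ico_of_mult_ne_zero (a₀ := b) (fun m hm => hb m hm.le) (Int.natCast_nonneg i) hR
  refine ⟨coeff_seriesAt_ne_zero_iff k₀ hγ n i _ hs, fun hn => ?_⟩
  rw [valuation_coeff_seriesAt k₀ hγ n i _ hs hn, height_eq_sum hs]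
  push_cast
  rfl

/-- Outside of the range where the coefficients of `G_{k_n}` vanish, the ghost slope `s_i(k_n)`
is linear in `i` up to a logarithm. -/
theorem exists_slope_bound {d dnew : ℤ → ℤ} (hG : Tendsto d atTop atTop)
    (hG' : Tendsto (fun n => d n + dnew n) atBot atBot) (k₀ : ℤ) {γ : ℤ_[p]ˣ}
    (hγ : IsTopGen p γ) {A B : ℝ} (hA : 0 < A) (hB : 0 < B)
    (hLG : (fun n : ℤ => (d n : ℝ) - A * n) =O[atTop] fun _ => (1 : ℝ))
    (hLG' : (fun n : ℤ => (dnew n : ℝ) - B * n) =O[atTop] fun _ => (1 : ℝ)) :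
    ∃ C : ℝ, 0 ≤ C ∧ ∀ n i : ℤ, 0 ≤ n → 1 ≤ i → mult d dnew i n = 0 →
      mult d dnew (i - 1) n = 0 →
      |ghostSlope p d dnew k₀ γ i n -
        avgWgt p * (B ^ 2 / (A * (A + B) * (2 * A + B))) * i| ≤
        C * Real.log ((n : ℝ) + i + 2) := by
  have hl2 : 0 < Real.log 2 := Real.log_pos one_lt_two
  have hav := avgWgt_pos (p := p)
  obtain ⟨C, hC0, hC⟩ := exists_height_increment (p := p) hG hG' hA hB hLG hLG'
  set α := avgWgt p * (B ^ 2 / (A * (A + B) * (2 * A + B))) with hα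
  have hα0 : 0 < α := by positivity
  obtain ⟨c, hc0, hc⟩ := exists_mul_log_one_add_le hC0 hα0
  refine ⟨C + c / Real.log 2, by positivity, fun n i' hn hi' h1 h0 => ?_⟩
  obtain ⟨i, hi⟩ := Int.eq_ofNat_of_zero_le (show 0 ≤ i' - 1 by omega)
  obtain rfl : i' = (i : ℤ) + 1 := by omega
  rw [add_sub_cancel_right] at h0
  have hn' : (0 : ℝ) ≤ n := by exact_mod_cast hn
  have hcoef := coeff_seriesAt_height hG hG' k₀ hγ n
  have c0 := (hcoef i).1.mpr h0
  have h1' : mult d dnew ((i + 1 : ℕ) : ℤ) n = 0 := by push_cast; exact h1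
  have c1 := (hcoef (i + 1)).1.mpr h1'
  have v0 := (hcoef i).2 h0
  have v1 := (hcoef (i + 1)).2 h1'
  have hinc : ∀ j : ℕ, |height p d dnew n (j + 1 : ℕ) - height p d dnew n j -
      α * ((j : ℝ) + 1)| ≤ C * Real.log ((n : ℝ) + j + 3) := by
    intro j
    have h := hC n ((j : ℤ) + 1) hn (by omega)
    rw [add_sub_cancel_right] at h
    push_cast at h ⊢
    rwa [show (n : ℝ) + j + 3 = n + (j + 1) + 2 by ring]
  have hL : Real.log ((n : ℝ) + i + 3) = Real.log ((n : ℝ) + ((i : ℤ) + 1 : ℤ) + 2) := by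
    push_cast; congr 1; ring
  rw [← hL]
  have hcl : c ≤ c / Real.log 2 * Real.log ((n : ℝ) + i + 3) := by
    have := le_mul_log_add_two hc0 (show 0 ≤ (n : ℝ) + i + 1 by positivity)
    rwa [show (n : ℝ) + i + 1 + 2 = n + i + 3 by ring] at this
  -- Increments at or before the step from `i` to `i + 1` are bounded by the largest main term and
  -- the largest logarithm, both at `j = i`.
  have upper : ghostSlope p d dnew k₀ γ ((i : ℤ) + 1) n ≤
      α * ((i : ℝ) + 1) + C * Real.log ((n : ℝ) + i + 3) := by
    refine slope_le _ c0 c1 fun a ha hca => ?_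
    rw [v1, (hcoef a).2 ((hcoef a).1.mp hca)]
    have := sub_le_mul_of_forall_succ (f := fun j : ℕ => height p d dnew n j)
      (s := α * ((i : ℝ) + 1) + C * Real.log ((n : ℝ) + i + 3)) (a := a) (b := i + 1) (by omega)
      fun j _ hj => by
        have hj' : (j : ℝ) ≤ i := by exact_mod_cast (show j ≤ i by omega)
        have g1 := (abs_le.mp (hinc j)).2
        have g2 : Real.log ((n : ℝ) + j + 3) ≤ Real.log ((n : ℝ) + i + 3) :=
          Real.log_le_log (by positivity) (by linarith)
        have g3 := mul_le_mul_of_nonneg_left g2 hC0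
        have g4 := mul_le_mul_of_nonneg_left hj' hα0.le
        linarith
    push_cast at this ⊢
    linarith
  -- To the right of `i` the logarithmic error is unbounded in `j`, but its excess over the error at
  -- `i` is at most `C * log (1 + (j - i))`, which the gain `α * (j - i)` of the main term
  -- compensates up to the constant `c`.
  have lower : α * ((i : ℝ) + 1) - (C * Real.log ((n : ℝ) + i + 3) + c) ≤
      ghostSlope p d dnew k₀ γ ((i : ℤ) + 1) n := by
    refine le_slope _ c0 c1 fun b hib hcb => ?_
    rw [v0, (hcoef b).2 ((hcoef b).1.mp hcb)]
    have := sub_le_mul_of_forall_succ (f := fun j : ℕ => -height p d dnew n j)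
      (s := -(α * ((i : ℝ) + 1) - (C * Real.log ((n : ℝ) + i + 3) + c))) (a := i) (b := b)
      (by omega) fun j hj _ => by
        have hj' : (i : ℝ) ≤ j := by exact_mod_cast hj
        have g1 := (abs_le.mp (hinc j)).1
        have g2 : Real.log ((n : ℝ) + j + 3) ≤
            Real.log ((n : ℝ) + i + 3) + Real.log (1 + ((j : ℝ) - i)) := by
          have q0 : 0 < 1 + ((j : ℝ) - i) := by linarith
          rw [← Real.log_mul (by positivity) q0.ne']
          have q1 : 0 ≤ ((n : ℝ) + i + 2) * ((j : ℝ) - i) :=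
            mul_nonneg (by positivity) (by linarith)
          exact Real.log_le_log (by positivity) (by linarith)
        have g3 := mul_le_mul_of_nonneg_left g2 hC0
        have g4 := hc ((j : ℝ) - i) (by linarith)
        linarith
    linarith
  rw [abs_le]
  push_cast
  constructor <;> linarith

/-- Both cases of the mean weight take one shape, whose factor `δ` turns `n` into `k_n` up to a
bounded amount. -/
theorem avgWgt_eq : avgWgt p = (p : ℝ) / ((p : ℝ) - 1) ^ 2 * delta p := by
  have hp := (Fact.out : p.Prime).two_le
  have hp1 : (p : ℝ) - 1 ≠ 0 := by
    have : (2 : ℝ) ≤ p := by exact_mod_cast hp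
    linarith
  unfold avgWgt delta
  split_ifs with h
  · subst h; norm_num
  · push_cast
    field_simp
    ring

/-- Common form of both estimates: `I` is an index of growth rate `lam` at which the points over `I
n - 1` and `I n` are both present. -/
theorem slope_isBigO_log {d dnew : ℤ → ℤ} (hG : Tendsto d atTop atTop)
    (hG' : Tendsto (fun n => d n + dnew n) atBot atBot) (k₀ : ℤ) {γ : ℤ_[p]ˣ}
    (hγ : IsTopGen p γ) {A B : ℝ} (hA : 0 < A) (hB : 0 < B)
    (hLG : (fun n : ℤ => (d n : ℝ) - A * n) =O[atTop] fun _ => (1 : ℝ))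
    (hLG' : (fun n : ℤ => (dnew n : ℝ) - B * n) =O[atTop] fun _ => (1 : ℝ))
    {I : ℤ → ℤ} {lam : ℝ} (hI : (fun n : ℤ => (I n : ℝ) - lam * n) =O[atTop] fun _ => (1 : ℝ))
    (hI1 : ∀ᶠ n in atTop, 1 ≤ I n ∧ mult d dnew (I n) n = 0 ∧ mult d dnew (I n - 1) n = 0) :
    (fun n : ℤ => ghostSlope p d dnew k₀ γ (I n) n -
      (p : ℝ) / ((p : ℝ) - 1) ^ 2 * (lam * (B ^ 2 / (A * (A + B) * (2 * A + B)))) *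
        (wt p k₀ n : ℝ)) =O[atTop] fun n : ℤ => Real.log (n : ℝ) := by
  have hl2 : 0 < Real.log 2 := Real.log_pos one_lt_two
  obtain ⟨C, hC0, hC⟩ := exists_slope_bound hG hG' k₀ hγ hA hB hLG hLG'
  obtain ⟨K, hK0, hK⟩ := exists_abs_le_of_isBigO_one hI
  set β := B ^ 2 / (A * (A + B) * (2 * A + B)) with hβ
  set D := |lam| + K + 1 with hD
  have hD0 : 0 ≤ D := by positivity
  have hlD : 0 ≤ Real.log (D + 2) := Real.log_nonneg (by linarith)
  set E := |avgWgt p * β| * K + |(p : ℝ) / ((p : ℝ) - 1) ^ 2 * (lam * β) * k₀| with hE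
  have hE0 : 0 ≤ E := by positivity
  refine IsBigO.of_bound (C * ((Real.log (D + 2) / Real.log 2 + 1) * 2) + E / Real.log 2) ?_
  filter_upwards [hK, hI1, eventually_ge_atTop (2 : ℤ)] with n hKn hIn hn
  obtain ⟨h1, hm1, hm0⟩ := hIn
  have hn' : (2 : ℝ) ≤ n := by exact_mod_cast hn
  have h1' : (1 : ℝ) ≤ I n := by exact_mod_cast h1
  have hlogn : Real.log 2 ≤ Real.log n := Real.log_le_log two_pos hn'
  have hlog2 : Real.log ((n : ℝ) + 2) ≤ 2 * Real.log n := by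
    rw [← Real.log_rpow (by linarith)]
    refine Real.log_le_log (by linarith) ?_
    rw [Real.rpow_two]
    nlinarith
  have hlog : Real.log ((n : ℝ) + I n + 2) ≤
      (Real.log (D + 2) / Real.log 2 + 1) * Real.log ((n : ℝ) + 2) := by
    refine log_add_two_le hD0 (by linarith) (by linarith) ?_
    have q1 := (abs_le.mp hKn).2
    have q2 : lam * n ≤ |lam| * n := mul_le_mul_of_nonneg_right (le_abs_self _) (by linarith)
    have q3 : 0 ≤ K * n := by positivity
    rw [hD]
    nlinarith [abs_nonneg lam]
  have hs := hC n (I n) (by omega) h1 hm1 hm0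
  have hs' : C * Real.log ((n : ℝ) + I n + 2) ≤
      C * ((Real.log (D + 2) / Real.log 2 + 1) * 2) * Real.log n := by
    rw [mul_assoc]
    refine mul_le_mul_of_nonneg_left ?_ hC0
    rw [mul_assoc]
    exact hlog.trans (mul_le_mul_of_nonneg_left hlog2 (by positivity))
  have hEl : E ≤ E / Real.log 2 * Real.log n := by
    rw [div_mul_eq_mul_div, le_div_iff₀ hl2]
    exact mul_le_mul_of_nonneg_left hlogn hE0
  have hrest : |avgWgt p * β * I n -
      (p : ℝ) / ((p : ℝ) - 1) ^ 2 * (lam * β) * (wt p k₀ n : ℝ)| ≤ E := by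
    have e : avgWgt p * β * I n -
        (p : ℝ) / ((p : ℝ) - 1) ^ 2 * (lam * β) * (wt p k₀ n : ℝ) =
        avgWgt p * β * (I n - lam * n) - (p : ℝ) / ((p : ℝ) - 1) ^ 2 * (lam * β) * k₀ := by
      rw [avgWgt_eq, wt]
      push_cast
      ring
    rw [e, hE]
    refine (abs_sub _ _).trans (add_le_add ?_ le_rfl)
    rw [abs_mul]
    exact mul_le_mul_of_nonneg_left hKn (abs_nonneg _)
  rw [Real.norm_eq_abs, Real.norm_eq_abs, abs_of_nonneg (hl2.le.trans hlogn), add_mul]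
  refine (abs_sub_le _ (avgWgt p * β * I n) _).trans ?_
  linarith

end Ghost

/-! ### The two asymptotic formulas. -/

theorem corollary3p2 (p : ℕ) [Fact p.Prime] (d dnew : ℤ → ℤ) (k₀ : ℤ) (γ : ℤ_[p]ˣ)
    (hk₀ : 0 ≤ k₀) (hk₀' : k₀ < Ghost.delta p) (hγ : Ghost.IsTopGen p γ)
    -- growth
    (hG : Tendsto d atTop atTop)
    (hG' : Tendsto (fun n => d n + dnew n) atBot atBot)
    -- monotonicity
    (hND : Monotone d) (hND' : Monotone fun n => d n + dnew n)
    (hND'' : Monotone fun n => 2 * d n + dnew n)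
    -- linear growth up to a bounded error, as `n → +∞`
    (A B : ℝ) (hA : 0 < A) (hB : 0 < B)
    (hLG : (fun n : ℤ => (d n : ℝ) - A * n) =O[atTop] fun _ => (1 : ℝ))
    (hLG' : (fun n : ℤ => (dnew n : ℝ) - B * n) =O[atTop] fun _ => (1 : ℝ)) :
    ((fun n : ℤ => Ghost.ghostSlope p d dnew k₀ γ (d n) n -
        (p : ℝ) / ((p : ℝ) - 1) ^ 2 * (B ^ 2 / ((A + B) * (2 * A + B))) * (Ghost.wt p k₀ n : ℝ))
      =O[atTop] fun n : ℤ => Real.log (n : ℝ)) ∧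
    ∀ ε : ℝ, 0 < ε →
      (fun n : ℤ => Ghost.ghostSlope p d dnew k₀ γ (2 * d n + dnew n) n -
        (p : ℝ) / ((p : ℝ) - 1) ^ 2 * (B ^ 2 / (A * (A + B))) * (Ghost.wt p k₀ n : ℝ))
      =O[atTop] fun n : ℤ => (n : ℝ) ^ (1 / 2 + ε) := by
  have h1 : ∀ᶠ n in atTop, 1 ≤ d n := hG.eventually_ge_atTop 1
  have hnew : ∀ᶠ n in atTop, 0 ≤ dnew n := by
    obtain ⟨K, -, hK⟩ := exists_abs_le_of_isBigO_one hLG'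
    have hcast : Tendsto (fun n : ℤ => B * (n : ℝ)) atTop atTop :=
      tendsto_intCast_atTop_atTop.const_mul_atTop hB
    filter_upwards [hK, hcast.eventually_ge_atTop K] with n hn hn'
    have : (0 : ℝ) ≤ dnew n := by linarith [(abs_le.mp hn).1]
    exact_mod_cast this
  have hAB : A + B ≠ 0 := by positivity
  have hAB' : 2 * A + B ≠ 0 := by positivity
  refine ⟨?_, fun ε hε => ?_⟩
  · have h := Ghost.slope_isBigO_log hG hG' k₀ hγ hA hB hLG hLG' hLG (h1.mono fun n hn =>
      ⟨hn, Ghost.mult_eq_zero (Or.inl le_rfl), Ghost.mult_eq_zero (Or.inl (by omega))⟩)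
    have e : A * (B ^ 2 / (A * (A + B) * (2 * A + B))) = B ^ 2 / ((A + B) * (2 * A + B)) := by
      field_simp
    rwa [e] at h
  · have hI : (fun n : ℤ => ((2 * d n + dnew n : ℤ) : ℝ) - (2 * A + B) * n) =O[atTop]
        fun _ => (1 : ℝ) := by
      refine ((hLG.const_mul_left 2).add hLG').congr_left fun n => ?_
      push_cast
      ring
    have h := Ghost.slope_isBigO_log hG hG' k₀ hγ hA hB hLG hLG' hI (by
      filter_upwards [h1, hnew] with n hn hn'
      -- Since `d n ≥ 1`, even the index `d_p(n) - 1` is at least `d(n) + d^new(n)`, beyond the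
      -- range of vanishing coefficients.
      exact ⟨by omega, Ghost.mult_eq_zero (Or.inr (by omega)),
        Ghost.mult_eq_zero (Or.inr (by omega))⟩)
    have e : (2 * A + B) * (B ^ 2 / (A * (A + B) * (2 * A + B))) = B ^ 2 / (A * (A + B)) := by
      field_simp
    rw [e] at h
    -- The bound obtained is `O(log n)`; it is weakened to the stated power of `n`.
    exact h.trans
      ((isLittleO_log_rpow_atTop (by positivity)).isBigO.comp_tendsto tendsto_intCast_atTop_atTop)
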